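/- Let $\mathcal C_2$ be the two-dimensional comb, i.e. the graph with vertex set $\mathbb Z^2$ obtained from the square lattice by removing all horizontal edges except those on the $x$-axis, and let $o=(0,0)$. For $m\in\mathbb N_0$ let $$B_m=\{(x,y)\in\mathbb Z^2:\ |x|\le m,\ |y|\le h(m-|x|)\},\qquad h(x)=\left\lfloor \frac{(x+1)^2}{3}\right\rfloor,$$ and let $\partial B_m$ be the set of those $z\in B_m$ that have a neighbour in $\mathcal C_2$ outside $B_m$. For $z\in\partial B_m$ let $\nu_{m,o}(z)$ be the harmonic measure of $B_m$, i.e. the probability that the simple random walk on $\mathcal C_2$ started at $o$ hits $\partial B_m$ for the first time (time $0$ included) in $z$. Then there exist a function $e:\mathbb N_0\to\mathbb Q_{>0}$ with $e(0)=1$, not depending on $m$, and a real number $c$ with $0<c<\tfrac12$, such that $$\lim_{x\to\infty}\frac{e(x)}{x}=c,$$ and such that for every $m\ge 0$ the harmonic measure is proportional to $e(m-|z_x|)$: there is a constant $K_m>0$ with $$\nu_{m,o}(z)=K_m\, e(m-|z_x|)\qquad\text{for all } z=(z_x,z_y)\in\partial B_m .$$ -/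

import Mathlib

open MeasureTheory ProbabilityTheory Filter Topology

/-- The two-dimensional comb: the vertex set is `ℤ × ℤ`; the edges are all vertical edges of the
square lattice, together with the horizontal edges on the `x`-axis. -/
def comb : SimpleGraph (ℤ × ℤ) where
  Adj p q := (p.1 = q.1 ∧ |p.2 - q.2| = 1) ∨ (p.2 = 0 ∧ q.2 = 0 ∧ |p.1 - q.1| = 1)
  symm := ⟨fun p q h => by
    rcases h with ⟨h1, h2⟩ | ⟨h1, h2, h3⟩
    · exact Or.inl ⟨h1.symm, by rwa [abs_sub_comm]⟩
    · exact Or.inr ⟨h2, h1, by rwa [abs_sub_comm]⟩⟩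
  loopless := ⟨fun p h => by simp at h⟩

theorem comb_neighborSet_finite (v : ℤ × ℤ) : (comb.neighborSet v).Finite := by
  refine Set.Finite.subset
    ((Set.finite_Icc (v.1 - 1) (v.1 + 1)).prod (Set.finite_Icc (v.2 - 1) (v.2 + 1))) ?_
  rintro ⟨x, y⟩ h
  simp only [SimpleGraph.mem_neighborSet, comb] at h
  simp only [Set.mem_prod, Set.mem_Icc]
  grind

theorem comb_neighborSet_nonempty (v : ℤ × ℤ) : (comb.neighborSet v).Nonempty :=
  ⟨(v.1, v.2 + 1), Or.inl (by simp)⟩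

/-- The transition kernel of the simple random walk on the comb: from `v`, jump to a uniformly
chosen neighbour of `v`. -/
noncomputable def combStep : Kernel (ℤ × ℤ) (ℤ × ℤ) where
  toFun v := uniformOn (comb.neighborSet v)
  measurable' := Measurable.of_discrete

instance combStep_isMarkovKernel : IsMarkovKernel combStep :=
  ⟨fun v => isProbabilityMeasure_uniformOn (comb_neighborSet_finite v)
    (comb_neighborSet_nonempty v)⟩

/-- The law, on the space of trajectories `ℕ → ℤ × ℤ`, of the simple random walk on the comb
started at `v`: the Markov chain with initial law `δ_v` and transition kernel `combStep`. -/
noncomputable def combWalk (v : ℤ × ℤ) : Measure (ℕ → ℤ × ℤ) :=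
  Kernel.trajMeasure (X := fun _ => ℤ × ℤ) (Measure.dirac v)
    (fun n => combStep.comap (fun ω => ω ⟨n, Finset.mem_Iic.2 le_rfl⟩) (measurable_pi_apply _))

/-- `B_m = {(x, y) : |x| ≤ m, |y| ≤ h (m - |x|)}`. The subtraction is used only for `|x| ≤ m`. -/
def combBall (h : ℕ → ℕ) (m : ℕ) : Set (ℤ × ℤ) :=
  {z | z.1.natAbs ≤ m ∧ z.2.natAbs ≤ h (m - z.1.natAbs)}

/-- The inner boundary of a set of vertices of the comb. -/
def innerBoundary (B : Set (ℤ × ℤ)) : Set (ℤ × ℤ) :=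
  {z | z ∈ B ∧ ∃ w, comb.Adj z w ∧ w ∉ B}

/-- The harmonic measure of `B` at `z` seen from `v`: the probability that the simple random walk
started at `v` hits the inner boundary of `B` (for the first time, time `0` included) in `z`. -/
noncomputable def harmonicMeasure (B : Set (ℤ × ℤ)) (v z : ℤ × ℤ) : ℝ :=
  (combWalk v).real
    {ω | ∃ n, ω n = z ∧ z ∈ innerBoundary B ∧ ∀ k < n, ω k ∉ innerBoundary B}

/-- The profile `h(x) = ⌊(x + 1)² / 3⌋` (floor division in `ℕ`). -/
def rotorProfile (x : ℕ) : ℕ := (x + 1) ^ 2 / 3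

/-! Fix `z` and let `H v` be the probability, starting from `v`, that the boundary is first hit in
`z`. Since `H` is harmonic off the boundary, it is affine along each half-column. Hence its second
difference on the axis is `(2 H - S) / h`, where `S` adds the values at the two ends of the column
(`axis_equation`). Let `w = greenProfile h` solve the homogeneous equation, starting from the tip.
Green's identity between `w` and `H (x, 0) + H (-x, 0)` gives `H` at the origin, up to a factor
depending only on `m`, as the boundary values weighted by `w k / h k` (`harmonicMeasure_combBall`).
As `w` starts at the tip, these weights do not involve `m`. Only harmonicity and boundary values
enter, not almost sure hitting.

For the growth, the profile `k (k + 2) / 3` would have Green profile exactly `k (k + 1) (k + 2) / 6`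
and flux `(k + 1) / 2`. The true profile exceeds it by at most `1 / 3`, so the ratio of the Green
profiles decreases from 1. It drops below 1, yet a telescoping bound keeps it above `1 / 2`
(`greenRatio_bounds`, `greenRatio_lower`). Its limit `l` gives `c = l / 2`. -/

/-! ### Cylinder probabilities and the Markov property -/

/-- Finite measures on sequences in a countable discrete space agree as soon as they agree on
all cylinders prescribing an initial segment. -/
theorem measure_ext_of_initial_segments {S : Type*} [MeasurableSpace S] [Countable S]
    [MeasurableSingletonClass S] (μ ν : Measure (ℕ → S)) [IsFiniteMeasure μ]
    [IsFiniteMeasure ν]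
    (h : ∀ (n : ℕ) (x : ℕ → S), μ {ω | ∀ i ≤ n, ω i = x i} = ν {ω | ∀ i ≤ n, ω i = x i}) :
    μ = ν := by
  have key : ∀ n : ℕ, μ.map (Preorder.frestrictLe n) = ν.map (Preorder.frestrictLe n) := by
    intro n
    refine Measure.ext_of_singleton fun y => ?_
    rw [Measure.map_apply (Preorder.measurable_frestrictLe n) (measurableSet_singleton y),
      Measure.map_apply (Preorder.measurable_frestrictLe n) (measurableSet_singleton y)]
    -- Capping the index at `n` extends `y` to a sequence on all of `ℕ`.
    have hs : Preorder.frestrictLe (π := fun _ => S) n ⁻¹' {y} =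
        {ω | ∀ i ≤ n, ω i = y ⟨min i n, by simp⟩} := by
      ext ω
      simp only [Set.mem_preimage, Set.mem_singleton_iff, Set.mem_ofPred_eq, funext_iff,
        Preorder.frestrictLe_apply, Subtype.forall, Finset.mem_Iic]
      refine forall_congr' fun i => forall_congr' fun hi => ?_
      simp [min_eq_left hi]
    rw [hs]
    exact h n (fun i => y ⟨min i n, by simp⟩)
  refine IsProjectiveLimit.unique (P := fun I => ν.map I.restrict) (fun I => ?_) fun I => rfl
  have hI : I ⊆ Finset.Iic (I.sup id) := fun i hi => by
    simpa using Finset.le_sup (f := id) hi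
  have hcomp : I.restrict (π := fun _ : ℕ => S) =
      Finset.restrict₂ hI ∘ Preorder.frestrictLe (I.sup id) := rfl
  dsimp only
  rw [hcomp, ← Measure.map_map (by fun_prop) (by fun_prop), key,
    Measure.map_map (by fun_prop) (by fun_prop)]

instance combWalk_isProbabilityMeasure (v : ℤ × ℤ) : IsProbabilityMeasure (combWalk v) := by
  unfold combWalk; infer_instance

theorem combWalk_map_zero (v : ℤ × ℤ) :
    (combWalk v).map (fun ω => ω 0) = Measure.dirac v := by
  have h : (combWalk v).map (Preorder.frestrictLe 0) =
      (Measure.dirac v).map (MeasurableEquiv.piUnique _).symm := by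
    rw [combWalk, Kernel.trajMeasure, Measure.map_comp _ _ (by fun_prop),
      Kernel.traj_map_frestrictLe, Kernel.partialTraj_self, Measure.id_comp]
  have h2 : (fun ω : ℕ → ℤ × ℤ => ω 0) =
      (fun y : (Π _ : Finset.Iic 0, ℤ × ℤ) => y ⟨0, by simp⟩) ∘ Preorder.frestrictLe 0 := rfl
  rw [h2, ← Measure.map_map (by fun_prop) (by fun_prop), h,
    Measure.map_map (by fun_prop) (by fun_prop), Measure.map_dirac' (by fun_prop)]
  rfl

theorem combWalk_ae_zero (v : ℤ × ℤ) : ∀ᵐ ω ∂(combWalk v), ω 0 = v := by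
  have : ∀ᵐ y ∂((combWalk v).map (fun ω => ω 0)), y = v := by
    rw [combWalk_map_zero]; simp [ae_dirac_eq]
  exact ae_of_ae_map (measurable_pi_apply 0).aemeasurable this

theorem combWalk_cylinder_succ (v : ℤ × ℤ) (n : ℕ) (x : ℕ → ℤ × ℤ) :
    combWalk v {ω | ∀ i ≤ n + 1, ω i = x i} =
      combWalk v {ω | ∀ i ≤ n, ω i = x i} * combStep (x n) {x (n + 1)} := by
  have h := Kernel.map_frestrictLe_trajMeasure_compProd_eq_map_trajMeasure
    (X := fun _ => ℤ × ℤ) (μ₀ := Measure.dirac v)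
    (κ := fun n => combStep.comap (fun ω => ω ⟨n, Finset.mem_Iic.2 le_rfl⟩)
      (measurable_pi_apply _)) (a := n)
  have h' := congrArg (fun μ => μ ({Preorder.frestrictLe n x} ×ˢ {x (n + 1)})) h
  rw [Measure.compProd_apply_prod (measurableSet_singleton _) (measurableSet_singleton _),
    Measure.map_apply (by fun_prop)
      ((measurableSet_singleton _).prod (measurableSet_singleton _)),
    lintegral_singleton, Measure.map_apply (by fun_prop) (measurableSet_singleton _)] at h'
  have hs : Preorder.frestrictLe (π := fun _ => ℤ × ℤ) n ⁻¹' {Preorder.frestrictLe n x} =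
      {ω | ∀ i ≤ n, ω i = x i} := by
    ext ω
    simp [funext_iff]
  have ht : (fun ω : ℕ → ℤ × ℤ => (Preorder.frestrictLe (π := fun _ => ℤ × ℤ) n ω, ω (n + 1))) ⁻¹'
      ({Preorder.frestrictLe n x} ×ˢ {x (n + 1)}) = {ω | ∀ i ≤ n + 1, ω i = x i} := by
    ext ω
    simp only [Set.mem_preimage, Set.mem_prod, Set.mem_singleton_iff, funext_iff, Subtype.forall,
      Finset.mem_Iic, Preorder.frestrictLe_apply, Set.mem_ofPred_eq]
    exact ⟨fun ⟨h1, h2⟩ i hi => (Nat.le_succ_iff.1 hi).elim (h1 i) (fun e => e ▸ h2),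
      fun h => ⟨fun i hi => h i (by omega), h _ le_rfl⟩⟩
  rw [hs, ht, mul_comm] at h'
  exact h'.symm

theorem combWalk_cylinder_zero (v : ℤ × ℤ) (x : ℕ → ℤ × ℤ) :
    combWalk v {ω | ∀ i ≤ 0, ω i = x i} = Measure.dirac v {x 0} := by
  rw [← combWalk_map_zero, Measure.map_apply (by fun_prop) (measurableSet_singleton _)]
  congr 1
  ext ω
  simp

/-- Prefixing `v` turns a shifted cylinder, up to a null set, into an ordinary one, to which the
product formula applies. -/
theorem combWalk_shift_cylinder (v : ℤ × ℤ) (n : ℕ) (x : ℕ → ℤ × ℤ) :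
    combWalk v {ω | ∀ i ≤ n, ω (i + 1) = x i} =
      combStep v {x 0} * combWalk (x 0) {ω | ∀ i ≤ n, ω i = x i} := by
  have hcons : ∀ k : ℕ, combWalk v {ω | ∀ i ≤ k, ω (i + 1) = x i} =
      combWalk v {ω | ∀ i ≤ k + 1, ω i = (fun j => Nat.casesOn j v x : ℕ → ℤ × ℤ) i} := by
    intro k
    refine measure_congr ?_
    filter_upwards [combWalk_ae_zero v] with ω hω
    refine propext ⟨fun h i hi => ?_, fun h i hi => h (i + 1) (by omega)⟩
    cases i with
    | zero => exact hω
    | succ i => exact h i (by omega)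
  induction n with
  | zero =>
    rw [hcons, combWalk_cylinder_succ, combWalk_cylinder_zero, combWalk_cylinder_zero]
    simp
  | succ n ih =>
    rw [hcons, combWalk_cylinder_succ, ← hcons, ih, combWalk_cylinder_succ, mul_assoc]

/-- The Markov property at time one. -/
theorem combWalk_map_shift (v : ℤ × ℤ) :
    (combWalk v).map (fun ω n => ω (n + 1)) = (combStep v).bind combWalk := by
  have hm : Measurable combWalk := Measurable.of_discrete
  have : IsProbabilityMeasure ((combStep v).bind combWalk) :=
    isProbabilityMeasure_bind hm.aemeasurable (Eventually.of_forall inferInstance)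
  have hshift : Measurable (fun (ω : ℕ → ℤ × ℤ) n => ω (n + 1)) := by fun_prop
  have : IsProbabilityMeasure ((combWalk v).map (fun ω n => ω (n + 1))) :=
    Measure.isProbabilityMeasure_map hshift.aemeasurable
  refine measure_ext_of_initial_segments _ _ fun n x => ?_
  have hmeas : MeasurableSet {ω : ℕ → ℤ × ℤ | ∀ i ≤ n, ω i = x i} := by
    simp only [Set.ofPred_forall]
    exact .iInter fun i => .iInter fun _ =>
      measurableSet_eq_fun (measurable_pi_apply i) measurable_const
  rw [Measure.map_apply hshift hmeas, Measure.bind_apply hmeas hm.aemeasurable]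
  refine (combWalk_shift_cylinder v n x).trans ?_
  -- The walk from `w` starts at `w` almost surely, so only the atom `w = x 0` contributes to the
  -- integral.
  have hsupp : ∀ w, combWalk w {ω | ∀ i ≤ n, ω i = x i} =
      ({x 0} : Set (ℤ × ℤ)).indicator (fun w => combWalk w {ω | ∀ i ≤ n, ω i = x i}) w := by
    intro w
    by_cases hw : w = x 0
    · simp [hw]
    · rw [Set.indicator_of_notMem (by simpa using hw)]
      refine measure_mono_null (t := {ω | ω 0 ≠ w}) (fun ω h => ?_) (combWalk_ae_zero w)
      exact fun h' => hw (h'.symm.trans (h 0 (Nat.zero_le _)))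
  rw [lintegral_congr hsupp, lintegral_indicator (measurableSet_singleton _), lintegral_singleton]
  simp [mul_comm]

/-! ### Hitting probabilities as harmonic functions -/

theorem measurableSet_firstHit (A : Set (ℤ × ℤ)) (z : ℤ × ℤ) :
    MeasurableSet {ω : ℕ → ℤ × ℤ | ∃ n, ω n = z ∧ z ∈ A ∧ ∀ k < n, ω k ∉ A} := by
  have hA : MeasurableSet A := .of_discrete
  have h1 : ∀ n, MeasurableSet {ω : ℕ → ℤ × ℤ | ω n = z} := fun n =>
    measurableSet_eq_fun (measurable_pi_apply n) measurable_const
  have h2 : ∀ k, MeasurableSet {ω : ℕ → ℤ × ℤ | ω k ∉ A} := fun k =>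
    (measurable_pi_apply (X := fun _ : ℕ => ℤ × ℤ) k) hA.compl
  simp only [Set.ofPred_exists, Set.ofPred_and, Set.ofPred_forall]
  exact .iUnion fun n => (h1 n).inter ((MeasurableSet.const _).inter
    (.iInter fun k => .iInter fun _ => h2 k))

theorem harmonicMeasure_boundary {B : Set (ℤ × ℤ)} {z b : ℤ × ℤ} (hz : z ∈ innerBoundary B)
    (hb : b ∈ innerBoundary B) : harmonicMeasure B b z = if b = z then 1 else 0 := by
  have h : ∀ᵐ ω ∂(combWalk b), (ω ∈ {ω : ℕ → ℤ × ℤ | ∃ n, ω n = z ∧ z ∈ innerBoundary B ∧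
      ∀ k < n, ω k ∉ innerBoundary B}) ↔ b = z := by
    filter_upwards [combWalk_ae_zero b] with ω hω
    constructor
    · rintro ⟨n, hn, -, hk⟩
      rcases Nat.eq_zero_or_pos n with rfl | hpos
      · exact hω.symm.trans hn
      · exact absurd (hω ▸ hb) (hk 0 hpos)
    · rintro rfl
      exact ⟨0, hω, hz, by simp⟩
  unfold harmonicMeasure
  split_ifs with hbz
  · rw [measureReal_def, (mem_ae_iff_prob_eq_one (measurableSet_firstHit _ _)).1]
    · simp
    · filter_upwards [h] with ω h using h.2 hbz
  · rw [measureReal_def, measure_eq_zero_iff_ae_notMem.2]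
    · simp
    · filter_upwards [h] with ω h using fun h' => hbz (h.1 h')

/-- Off the boundary no hit occurs at time `0`, so the shifted path hits at the same point one step
earlier, and the Markov property applies. -/
theorem harmonicMeasure_step {B : Set (ℤ × ℤ)} {z v : ℤ × ℤ} (hv : v ∉ innerBoundary B) :
    harmonicMeasure B v z = ∫ w, harmonicMeasure B w z ∂(combStep v) := by
  have hE := measurableSet_firstHit (innerBoundary B) z
  have hshift : Measurable (fun (ω : ℕ → ℤ × ℤ) n => ω (n + 1)) := by fun_prop
  have hm : Measurable combWalk := Measurable.of_discrete
  have h : combWalk v {ω : ℕ → ℤ × ℤ | ∃ n, ω n = z ∧ z ∈ innerBoundary B ∧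
      ∀ k < n, ω k ∉ innerBoundary B} = ∫⁻ w, combWalk w {ω : ℕ → ℤ × ℤ | ∃ n, ω n = z ∧
        z ∈ innerBoundary B ∧ ∀ k < n, ω k ∉ innerBoundary B} ∂(combStep v) := by
    rw [← Measure.bind_apply hE hm.aemeasurable, ← combWalk_map_shift,
      Measure.map_apply hshift hE]
    refine measure_congr ?_
    filter_upwards [combWalk_ae_zero v] with ω hω
    refine propext ⟨?_, ?_⟩
    · rintro ⟨n, hn, hz, hk⟩
      cases n with
      | zero => exact absurd (hω.symm.trans hn ▸ hz) hv
      | succ n => exact ⟨n, hn, hz, fun k hkn => hk (k + 1) (by omega)⟩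
    · rintro ⟨n, hn, hz, hk⟩
      refine ⟨n + 1, hn, hz, fun k hkn => ?_⟩
      cases k with
      | zero => exact hω ▸ hv
      | succ k => exact hk k (by omega)
  unfold harmonicMeasure
  simp_rw [measureReal_def]
  rw [h, integral_toReal Measurable.of_discrete.aemeasurable
    (Eventually.of_forall fun w => measure_lt_top _ _)]

theorem integral_uniformOn_finset {S : Type*} [MeasurableSpace S]
    [MeasurableSingletonClass S] (s : Finset S) (f : S → ℝ) :
    ∫ w, f w ∂(uniformOn (s : Set S)) = (∑ w ∈ s, f w) / s.card := by
  rw [uniformOn, ProbabilityTheory.cond, integral_smul_measure, setIntegral_finset s]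
  · simp [div_eq_inv_mul, measureReal_def]
  · rw [← Set.biUnion_of_singleton (s : Set S), integrableOn_finite_biUnion s.finite_toSet]
    exact fun x _ => integrableOn_singleton (by finiteness) (by simp)

theorem integral_combStep_off_axis (x y : ℤ) (hy : y ≠ 0) (f : ℤ × ℤ → ℝ) :
    ∫ w, f w ∂(combStep (x, y)) = (f (x, y + 1) + f (x, y - 1)) / 2 := by
  have h : comb.neighborSet (x, y) = (({(x, y + 1), (x, y - 1)} : Finset (ℤ × ℤ)) : Set _) := by
    ext ⟨a, b⟩
    simp only [SimpleGraph.mem_neighborSet, comb, Finset.coe_insert, Finset.coe_singleton,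
      Set.mem_insert_iff, Set.mem_singleton_iff, Prod.mk.injEq]
    grind
  change ∫ w, f w ∂(uniformOn (comb.neighborSet (x, y))) = _
  rw [h, integral_uniformOn_finset, Finset.sum_pair (by simp; omega),
    Finset.card_pair (by simp; omega)]
  norm_num

theorem integral_combStep_axis (x : ℤ) (f : ℤ × ℤ → ℝ) :
    ∫ w, f w ∂(combStep (x, 0)) =
      (f (x, 1) + f (x, -1) + f (x + 1, 0) + f (x - 1, 0)) / 4 := by
  have h : comb.neighborSet (x, 0) =
      (({(x, 1), (x, -1), (x + 1, 0), (x - 1, 0)} : Finset (ℤ × ℤ)) : Set _) := by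
    ext ⟨a, b⟩
    simp only [SimpleGraph.mem_neighborSet, comb, Finset.coe_insert, Finset.coe_singleton,
      Set.mem_insert_iff, Set.mem_singleton_iff, Prod.mk.injEq]
    grind
  change ∫ w, f w ∂(uniformOn (comb.neighborSet (x, 0))) = _
  rw [h, integral_uniformOn_finset]
  repeat rw [Finset.sum_insert (by simp <;> omega)]
  repeat rw [Finset.card_insert_of_notMem (by simp <;> omega)]
  simp
  ring

/-! ### Green's identity along the axis -/

/-- Horizontal edges leave the ball only at the tips, where `h 0 = 0` makes the tip the end of its
own column. -/
theorem innerBoundary_combBall {h : ℕ → ℕ} (h0 : h 0 = 0) (m : ℕ) :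
    innerBoundary (combBall h m) = {z | z.1.natAbs ≤ m ∧ z.2.natAbs = h (m - z.1.natAbs)} := by
  ext ⟨x, y⟩
  simp only [innerBoundary, combBall, Set.mem_ofPred_eq, Prod.exists, comb]
  constructor
  · rintro ⟨⟨hx, hy⟩, a, b, hadj, hout⟩
    refine ⟨hx, ?_⟩
    by_contra hne
    apply hout
    rcases hadj with ⟨rfl, hb⟩ | ⟨rfl, rfl, ha⟩
    · refine ⟨hx, ?_⟩
      grind
    · have hxm : x.natAbs ≠ m := fun e => hne (by simp [e, h0])
      exact ⟨by grind, by simp⟩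
  · rintro ⟨hx, hy⟩
    refine ⟨⟨hx, hy.le⟩, x, if 0 ≤ y then y + 1 else y - 1, Or.inl ⟨rfl, ?_⟩, ?_⟩
    · split_ifs <;> simp
    · rintro ⟨-, h'⟩
      grind

/-- A sequence which is affine in the interior of an interval is affine on that interval. -/
theorem affine_of_midpoint (n : ℕ) (g : ℕ → ℝ)
    (hg : ∀ y, y + 1 < n → 2 * g (y + 1) = g (y + 2) + g y) (k : ℕ) (hk : k ≤ n) :
    g k = g 0 + k * (g 1 - g 0) := by
  induction k using Nat.twoStepInduction with
  | zero => simp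
  | one => simp
  | more k ih1 ih2 =>
    have h := hg k (by omega)
    rw [ih1 (by omega), ih2 (by omega)] at h
    push_cast at h ⊢
    linarith

/-- The solution of `w (k + 1) - 2 w k + w (k - 1) = 2 w k / h k` with `w 0 = 0` and `w 1 = 1`:
the Green function of the ball with profile `h`, up to a constant, as a function of the distance
to the tip of the ball. -/
def greenProfile (h : ℕ → ℕ) : ℕ → ℚ
  | 0 => 0
  | 1 => 1
  | k + 2 => (2 + 2 / h (k + 1)) * greenProfile h (k + 1) - greenProfile h k

/-- The flux of the Green function into the boundary point of a column. -/
def fluxProfile (h : ℕ → ℕ) (k : ℕ) : ℚ :=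
  -- At the tip the quotient would be `0 / 0 = 0`; the value `1` is the coefficient of `G 0` in
  -- Green's identity.
  if k = 0 then 1 else greenProfile h k / h k

/-- The second difference is nonnegative wherever the sequence is positive, so the increase from `0`
to `1` persists. -/
theorem greenProfile_mono_pos (h : ℕ → ℕ) (k : ℕ) :
    greenProfile h k ≤ greenProfile h (k + 1) ∧ 0 < greenProfile h (k + 1) := by
  induction k with
  | zero => simp [greenProfile]
  | succ k ih =>
    have h2 : greenProfile h (k + 2) =
      (2 + 2 / h (k + 1)) * greenProfile h (k + 1) - greenProfile h k := rfl
    have h3 : 0 ≤ 2 / (h (k + 1) : ℚ) * greenProfile h (k + 1) :=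
      mul_nonneg (by positivity) ih.2.le
    constructor <;> linarith [ih.1, ih.2]

theorem greenProfile_pos (h : ℕ → ℕ) {k : ℕ} (hk : 0 < k) : 0 < greenProfile h k := by
  obtain ⟨k, rfl⟩ := Nat.exists_eq_succ_of_ne_zero hk.ne'
  exact (greenProfile_mono_pos h k).2

theorem fluxProfile_pos {h : ℕ → ℕ} (hpos : ∀ k, 0 < k → 0 < h k) (k : ℕ) :
    0 < fluxProfile h k := by
  unfold fluxProfile
  split_ifs with hk
  · exact one_pos
  · exact div_pos (greenProfile_pos h (by omega)) (by exact_mod_cast hpos k (by omega))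

theorem fluxProfile_mul {h : ℕ → ℕ} {k : ℕ} (hk : 0 < k) :
    fluxProfile h k = greenProfile h k / h k := by
  simp [fluxProfile, hk.ne']

/-- The discrete Green identity on a half-line, between the Green profile and a function `G`
solving the same equation with inhomogeneity `S`. -/
theorem greenProfile_identity {h : ℕ → ℕ} (hpos : ∀ k, 0 < k → 0 < h k) (m : ℕ) (G S : ℕ → ℝ)
    (hG : ∀ k, k + 1 < m → G (k + 2) + G k - 2 * G (k + 1) =
      (2 * G (k + 1) - S (k + 1)) / h (k + 1)) (n : ℕ) (hn : n < m) :
    greenProfile h (n + 1) * G n - greenProfile h n * G (n + 1) =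
      G 0 + ∑ k ∈ Finset.range n, (fluxProfile h (k + 1) : ℝ) * S (k + 1) := by
  induction n with
  | zero => simp [greenProfile]
  | succ n ih =>
    have hh : (h (n + 1) : ℝ) ≠ 0 := by exact_mod_cast (hpos (n + 1) (by omega)).ne'
    have hG' : G (n + 2) = 2 * G (n + 1) - G n + (2 * G (n + 1) - S (n + 1)) / h (n + 1) := by
      linarith [hG n hn]
    have hw : greenProfile h (n + 2) =
      (2 + 2 / h (n + 1)) * greenProfile h (n + 1) - greenProfile h n := rfl
    -- The terms `2 / h` cancel between the two equations, so each step adds only the flux times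
    -- `S`.
    rw [Finset.sum_range_succ, ← add_assoc, ← ih (by omega), hG', hw,
      fluxProfile_mul n.succ_pos]
    push_cast
    field_simp
    ring

/-- On the axis, a function harmonic in the interior of a ball solves a one-dimensional
equation whose inhomogeneity comes from its values on the boundary. -/
theorem axis_equation {h : ℕ → ℕ} (hpos : ∀ k, 0 < k → 0 < h k) (m : ℕ) (H : ℤ × ℤ → ℝ)
    (hcol : ∀ x y : ℤ, x.natAbs ≤ m → y ≠ 0 → y.natAbs < h (m - x.natAbs) →
      H (x, y) = (H (x, y + 1) + H (x, y - 1)) / 2)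
    (haxis : ∀ x : ℤ, x.natAbs < m →
      H (x, 0) = (H (x, 1) + H (x, -1) + H (x + 1, 0) + H (x - 1, 0)) / 4)
    (x : ℤ) (hx : x.natAbs < m) :
    H (x + 1, 0) + H (x - 1, 0) - 2 * H (x, 0) =
      (2 * H (x, 0) - (H (x, h (m - x.natAbs)) + H (x, -h (m - x.natAbs)))) /
        h (m - x.natAbs) := by
  have hh : (h (m - x.natAbs) : ℝ) ≠ 0 := by exact_mod_cast (hpos _ (by omega)).ne'
  have hup := affine_of_midpoint (h (m - x.natAbs)) (fun y => H (x, y)) (fun y hy => by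
    have := hcol x (y + 1) hx.le (by omega) (by omega)
    push_cast
    rw [this, add_sub_cancel_right, add_assoc, one_add_one_eq_two]
    ring) _ le_rfl
  have hdown := affine_of_midpoint (h (m - x.natAbs)) (fun y => H (x, -y)) (fun y hy => by
    have := hcol x (-(y + 1)) hx.le (by omega) (by omega)
    push_cast
    rw [this, show -((y : ℤ) + 1) + 1 = -y by ring,
      show -((y : ℤ) + 1) - 1 = -(y + 2) by ring]
    ring) _ le_rfl
  simp only [Nat.cast_zero, Nat.cast_one, neg_zero] at hup hdown
  rw [hup, hdown]
  have := haxis x hx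
  rw [eq_div_iff hh]
  linear_combination (-4 * (h (m - x.natAbs) : ℝ)) * this

/-- The harmonic measure of a ball seen from the origin is proportional to the flux profile. -/
theorem harmonicMeasure_combBall {h : ℕ → ℕ} (h0 : h 0 = 0) (hpos : ∀ k, 0 < k → 0 < h k)
    (m : ℕ) (hm : 0 < m) (z : ℤ × ℤ) (hz : z ∈ innerBoundary (combBall h m)) :
    2 * (greenProfile h m - greenProfile h (m - 1) + greenProfile h m / h m : ℚ) *
      harmonicMeasure (combBall h m) (0, 0) z = (fluxProfile h (m - z.1.natAbs) : ℝ) := by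
  have hbd : ∀ b : ℤ × ℤ, b ∈ innerBoundary (combBall h m) ↔
      b.1.natAbs ≤ m ∧ b.2.natAbs = h (m - b.1.natAbs) := fun b => by
    rw [innerBoundary_combBall h0]; rfl
  set H : ℤ × ℤ → ℝ := fun v => harmonicMeasure (combBall h m) v z with hH
  have hzb := (hbd z).1 hz
  have haxis := axis_equation hpos m H
    (fun x y hx hy hxy => by
      rw [hH]
      dsimp only
      rw [harmonicMeasure_step (fun hb => hxy.ne ((hbd _).1 hb).2),
        integral_combStep_off_axis _ _ hy])
    (fun x hx => by
      rw [hH]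
      dsimp only
      rw [harmonicMeasure_step (fun hb => (hpos (m - x.natAbs) (by omega)).ne ((hbd (x, 0)).1 hb).2),
        integral_combStep_axis])
  have htop : ∀ x : ℤ, x.natAbs < m → H (x, h (m - x.natAbs)) + H (x, -h (m - x.natAbs)) =
      if x = z.1 then 1 else 0 := by
    intro x hx
    have hp := hpos (m - x.natAbs) (by omega)
    rw [hH]
    dsimp only
    rw [harmonicMeasure_boundary hz ((hbd _).2 ⟨hx.le, by simp⟩),
      harmonicMeasure_boundary hz ((hbd _).2 ⟨hx.le, by simp⟩)]
    obtain ⟨a, b⟩ := z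
    simp only [Prod.mk.injEq] at hzb ⊢
    by_cases hxa : x = a
    · subst hxa
      rcases Int.natAbs_eq b with hb | hb <;> rw [hzb.2] at hb <;> rw [hb] <;>
        simp <;> omega
    · simp [hxa]
  have htip : ∀ x : ℤ, x.natAbs = m → H (x, 0) = if x = z.1 then 1 else 0 := by
    intro x hx
    rw [hH]
    dsimp only
    rw [harmonicMeasure_boundary hz ((hbd _).2 ⟨hx.le, by simp [hx, h0]⟩)]
    obtain ⟨a, b⟩ := z
    simp only [Prod.mk.injEq] at hzb ⊢
    refine if_congr ⟨fun e => e.1, fun e => ⟨e, ?_⟩⟩ rfl rfl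
    subst e
    rw [hx, Nat.sub_self, h0] at hzb
    omega
  have hax : ∀ x : ℤ, x.natAbs < m → H (x + 1, 0) + H (x - 1, 0) - 2 * H (x, 0) =
      (2 * H (x, 0) - if x = z.1 then 1 else 0) / h (m - x.natAbs) := fun x hx => by
    rw [haxis x hx, htop x hx]
  -- Adding the values at `x` and `-x` folds the axis into a half-line measured from the tips.
  have hI := greenProfile_identity hpos m
    (fun k => H ((m : ℤ) - k, 0) + H (-((m : ℤ) - k), 0))
    (fun k => if k = m - z.1.natAbs then 1 else 0) (fun k hk => by
      have h1 := hax ((m : ℤ) - (k + 1)) (by omega)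
      have h2 := hax (-((m : ℤ) - (k + 1))) (by omega)
      rw [show m - ((m : ℤ) - (k + 1)).natAbs = k + 1 by omega] at h1
      rw [show m - (-((m : ℤ) - (k + 1))).natAbs = k + 1 by omega] at h2
      -- Here `m - (k + 1)` is nonzero, so at most one indicator on the right equals 1.
      have hsum : (if k + 1 = m - z.1.natAbs then (1 : ℝ) else 0) =
          (if (m : ℤ) - (k + 1) = z.1 then 1 else 0) +
          (if -((m : ℤ) - (k + 1)) = z.1 then 1 else 0) := by
        split_ifs <;> first | omega | norm_num
      rw [hsum]
      push_cast
      rw [show (m : ℤ) - (k + 2) = m - (k + 1) - 1 by ring,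
        show -((m : ℤ) - (k + 1) - 1) = -(m - (k + 1)) + 1 by ring,
        show -((m : ℤ) - k) = -(m - (k + 1)) - 1 by ring,
        show (m : ℤ) - k = m - (k + 1) + 1 by ring]
      linear_combination h1 + h2) (m - 1) (by omega)
  -- The fold point needs its own equation; it supplies the weight of the central column and the
  -- term `greenProfile h m / h m`.
  have hcenter := hax 0 (by simpa using hm)
  have htip1 := htip m (by simp)
  have htip2 := htip (-m) (by simp)
  have hsym : H (1, 0) + H (-1, 0) = 2 * H (0, 0) +
      (2 * H (0, 0) - if 0 = z.1 then 1 else 0) / h m := by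
    simp only [zero_add, zero_sub, Int.natAbs_zero, Nat.sub_zero] at hcenter
    linarith
  have hcast : (m : ℤ) - ((m - 1 : ℕ) : ℤ) = 1 := by omega
  simp only [hcast, sub_self, Nat.cast_zero, sub_zero, neg_zero, htip1, htip2, hsym,
    Nat.sub_add_cancel hm] at hI
  have hh : (h m : ℝ) ≠ 0 := by exact_mod_cast (hpos m hm).ne'
  have hem : (fluxProfile h m : ℝ) = greenProfile h m / h m := by
    rw [fluxProfile_mul hm]; push_cast; rfl
  -- The column of `z` is central, a tip, or in between; exactly one of the three contributions
  -- survives.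
  have hflux : (fluxProfile h m : ℝ) * (if 0 = z.1 then 1 else 0) +
      ((if (m : ℤ) = z.1 then 1 else 0) + (if -(m : ℤ) = z.1 then 1 else 0)) +
      ∑ k ∈ Finset.range (m - 1), (fluxProfile h (k + 1) : ℝ) *
        (if k + 1 = m - z.1.natAbs then 1 else 0) = fluxProfile h (m - z.1.natAbs) := by
    by_cases hz0 : z.1 = 0
    · rw [Finset.sum_eq_zero fun k hk => by
        rw [if_neg (by have := Finset.mem_range.1 hk; omega), mul_zero]]
      rw [if_pos hz0.symm, if_neg (by omega), if_neg (by omega), hz0]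
      simp
    · rw [if_neg (Ne.symm hz0)]
      by_cases hzm : z.1.natAbs = m
      · rw [Finset.sum_eq_zero fun k hk => by rw [if_neg (by omega), mul_zero]]
        have : ((if (m : ℤ) = z.1 then (1 : ℝ) else 0) + (if -(m : ℤ) = z.1 then 1 else 0)) =
            1 := by
          split_ifs <;> first | omega | norm_num
        rw [this, hzm]
        simp [fluxProfile]
      · rw [if_neg (by omega), if_neg (by omega),
          Finset.sum_eq_single (m - z.1.natAbs - 1)
            (fun k _ hk => by rw [if_neg (by omega), mul_zero])
            (fun hk => absurd (Finset.mem_range.2 (by omega)) hk),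
          if_pos (by omega), show m - z.1.natAbs - 1 + 1 = m - z.1.natAbs by omega]
        ring
  change _ * H (0, 0) = _
  rw [← hflux, add_assoc, ← hI, hem]
  push_cast
  field_simp
  ring

/-! ### Asymptotics of the Green profile -/

/-- Squares are 0 or 1 modulo 3, so the floor loses at most `1 / 3`. -/
theorem rotorProfile_lower (k : ℕ) : (k : ℝ) * (k + 2) / 3 ≤ rotorProfile k := by
  have h : k * (k + 2) ≤ 3 * rotorProfile k := by
    unfold rotorProfile
    have h3 : (k + 1) ^ 2 % 3 ≤ 1 := by
      have : k % 3 < 3 := Nat.mod_lt _ (by norm_num)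
      interval_cases hk : k % 3 <;> simp [Nat.pow_mod, Nat.add_mod, hk]
    have h4 : k * (k + 2) + 1 = (k + 1) ^ 2 := by ring
    omega
  have h' : (k : ℝ) * (k + 2) ≤ 3 * rotorProfile k := by exact_mod_cast h
  linarith

theorem rotorProfile_upper (k : ℕ) : (rotorProfile k : ℝ) ≤ ((k : ℝ) + 1) ^ 2 / 3 := by
  have := Nat.cast_div_le (α := ℝ) (m := (k + 1) ^ 2) (n := 3)
  simpa [rotorProfile] using this

theorem rotorProfile_pos (k : ℕ) (hk : 0 < k) : 0 < rotorProfile k :=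
  Nat.div_pos (by nlinarith) (by norm_num)

/-- The ratio of the Green profile of `rotorProfile` to `k (k + 1) (k + 2) / 6`, which is the Green
profile of `k ↦ k (k + 2) / 3`. -/
noncomputable def greenRatio (k : ℕ) : ℝ :=
  (greenProfile rotorProfile k : ℝ) / ((k : ℝ) * (k + 1) * (k + 2) / 6)

/-- Comparing the two recurrences gives a first-order recursion `hd` for the decrements, driven by
the nonnegative profile error. The stated bound solves it exactly with the largest error and ratio 1
(`hc`). -/
theorem greenRatio_bounds (k : ℕ) :
    greenRatio (k + 1) ≤ 1 ∧ greenRatio (k + 2) ≤ greenRatio (k + 1) ∧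
      greenRatio (k + 1) - greenRatio (k + 2) ≤
        (2 * (k : ℝ) + 9) / (((k : ℝ) + 2) * (k + 3) ^ 2 * (k + 4)) := by
  induction k with
  | zero =>
    have h1 : greenRatio 1 = 1 := by norm_num [greenRatio, greenProfile]
    have h2 : greenRatio 2 = 1 := by norm_num [greenRatio, greenProfile, rotorProfile]
    norm_num [h1, h2]
  | succ k ih =>
    obtain ⟨h1, h2, h3⟩ := ih
    have hw : greenProfile rotorProfile (k + 3) = (2 + 2 / rotorProfile (k + 2)) *
      greenProfile rotorProfile (k + 2) - greenProfile rotorProfile (k + 1) := rfl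
    have hpos : (0 : ℝ) < greenProfile rotorProfile (k + 2) := by
      exact_mod_cast greenProfile_pos rotorProfile (by omega)
    set t : ℝ := (k : ℝ) with ht
    have ht0 : 0 ≤ t := by positivity
    have e1 : (greenProfile rotorProfile (k + 1) : ℝ) =
        greenRatio (k + 1) * ((t + 1) * (t + 2) * (t + 3) / 6) := by
      rw [greenRatio]; push_cast; rw [← ht]; field_simp; ring
    have e2 : (greenProfile rotorProfile (k + 2) : ℝ) =
        greenRatio (k + 2) * ((t + 2) * (t + 3) * (t + 4) / 6) := by
      rw [greenRatio]; push_cast; rw [← ht]; field_simp; ring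
    have e3 : (greenProfile rotorProfile (k + 3) : ℝ) =
        greenRatio (k + 3) * ((t + 3) * (t + 4) * (t + 5) / 6) := by
      rw [greenRatio]; push_cast; rw [← ht]; field_simp; ring
    have hlow := rotorProfile_lower (k + 2)
    have hup := rotorProfile_upper (k + 2)
    push_cast at hlow hup
    rw [← ht] at hlow hup
    set r : ℝ := (rotorProfile (k + 2) : ℝ) with hr
    have hw' : (greenProfile rotorProfile (k + 3) : ℝ) =
      (2 + 2 / r) * greenProfile rotorProfile (k + 2) - greenProfile rotorProfile (k + 1) := by
      rw [hw]; push_cast; rfl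
    rw [e1, e2, e3] at hw'
    have ha : 0 < greenRatio (k + 2) := by
      rw [e2] at hpos
      exact pos_of_mul_pos_left hpos (by positivity)
    have hr0 : 0 < r := lt_of_lt_of_le (by positivity) hlow
    have hd : ((t + 3) * (t + 4) * (t + 5) / 6) * (greenRatio (k + 2) - greenRatio (k + 3)) =
        ((t + 1) * (t + 2) * (t + 3) / 6) * (greenRatio (k + 1) - greenRatio (k + 2)) +
        (6 / ((t + 2) * (t + 4)) - 2 / r) * (greenRatio (k + 2) *
          ((t + 2) * (t + 3) * (t + 4) / 6)) := by
      field_simp at hw' ⊢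
      linarith
    have hδ0 : 0 ≤ 6 / ((t + 2) * (t + 4)) - 2 / r := by
      rw [sub_nonneg, div_le_div_iff₀ hr0 (by positivity)]
      linarith
    have hδ1 : 6 / ((t + 2) * (t + 4)) - 2 / r ≤ 6 / ((t + 2) * (t + 4) * (t + 3) ^ 2) := by
      have : 6 / (t + 3) ^ 2 ≤ 2 / r := by
        rw [div_le_div_iff₀ (by positivity) hr0]
        linarith
      have h6 : 6 / ((t + 2) * (t + 4)) - 6 / (t + 3) ^ 2 =
        6 / ((t + 2) * (t + 4) * (t + 3) ^ 2) := by field_simp; ring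
      linarith
    have hlt1 : greenRatio (k + 2) ≤ 1 := h2.trans h1
    refine ⟨hlt1, ?_, ?_⟩
    · have : 0 ≤ ((t + 3) * (t + 4) * (t + 5) / 6) *
          (greenRatio (k + 2) - greenRatio (k + 3)) := by
        rw [hd]
        have := sub_nonneg.2 h2
        positivity
      exact sub_nonneg.1 (nonneg_of_mul_nonneg_right this (by positivity))
    · have hb : ((t + 3) * (t + 4) * (t + 5) / 6) * (greenRatio (k + 2) - greenRatio (k + 3)) ≤
          ((t + 1) * (t + 2) * (t + 3) / 6) * ((2 * t + 9) / ((t + 2) * (t + 3) ^ 2 * (t + 4))) +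
          6 / ((t + 2) * (t + 4) * (t + 3) ^ 2) * (1 * ((t + 2) * (t + 3) * (t + 4) / 6)) := by
        rw [hd]
        gcongr
      have hc : ((t + 1) * (t + 2) * (t + 3) / 6) *
          ((2 * t + 9) / ((t + 2) * (t + 3) ^ 2 * (t + 4))) +
          6 / ((t + 2) * (t + 4) * (t + 3) ^ 2) * (1 * ((t + 2) * (t + 3) * (t + 4) / 6)) =
          ((t + 3) * (t + 4) * (t + 5) / 6) *
            ((2 * (t + 1) + 9) / ((t + 1 + 2) * (t + 1 + 3) ^ 2 * (t + 1 + 4))) := by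
        field_simp; ring
      rw [hc] at hb
      push_cast
      rw [← ht]
      exact le_of_mul_le_mul_left hb (by positivity)

/-- The decrements are at most `1 / (k + 2) - 1 / (k + 3)` and telescope from `greenRatio 1 = 1`. -/
theorem greenRatio_lower (k : ℕ) : 1 / 2 + 1 / ((k : ℝ) + 2) ≤ greenRatio (k + 1) := by
  induction k with
  | zero => norm_num [greenRatio, greenProfile]
  | succ k ih =>
    have h := (greenRatio_bounds k).2.2
    have h' : (2 * (k : ℝ) + 9) / (((k : ℝ) + 2) * (k + 3) ^ 2 * (k + 4)) ≤
        1 / ((k : ℝ) + 2) - 1 / ((k : ℝ) + 3) := by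
      rw [div_sub_div _ _ (by positivity) (by positivity),
        div_le_div_iff₀ (by positivity) (by positivity)]
      have hk : (0 : ℝ) ≤ k := by positivity
      have : 2 * (k : ℝ) + 9 ≤ (k + 3) * (k + 4) := by nlinarith
      have h5 : (0 : ℝ) ≤ (k + 2) * (k + 3) := by positivity
      nlinarith [mul_le_mul_of_nonneg_right this h5]
    push_cast
    rw [show (k : ℝ) + 1 + 2 = k + 3 by ring]
    linarith

theorem greenRatio_tendsto :
    ∃ l : ℝ, Tendsto greenRatio atTop (𝓝 l) ∧ 1 / 2 ≤ l ∧ l < 1 := by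
  have hanti : Antitone (fun k => greenRatio (k + 1)) :=
    antitone_nat_of_succ_le fun k => (greenRatio_bounds k).2.1
  have hlow : ∀ k, 1 / 2 ≤ greenRatio (k + 1) := fun k =>
    le_trans (le_add_of_nonneg_right (by positivity)) (greenRatio_lower k)
  have hbdd : BddBelow (Set.range fun k => greenRatio (k + 1)) :=
    ⟨1 / 2, by rintro _ ⟨k, rfl⟩; exact hlow k⟩
  refine ⟨_, (tendsto_add_atTop_iff_nat 1).1 (tendsto_atTop_ciInf hanti hbdd), le_ciInf hlow,
    -- The first ratio below 1 is `greenRatio 3 = 29 / 30`.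
    (ciInf_le hbdd 2).trans_lt ?_⟩
  norm_num [greenRatio, greenProfile, rotorProfile]

theorem fluxProfile_rotorProfile_tendsto :
    ∃ c : ℝ, Tendsto (fun x : ℕ => (fluxProfile rotorProfile x : ℝ) / (x : ℝ)) atTop (𝓝 c) ∧
      0 < c ∧ c < 1 / 2 := by
  obtain ⟨l, hl, hl0, hl1⟩ := greenRatio_tendsto
  refine ⟨l * (1 / 2), ?_, by linarith, by linarith⟩
  have hinv : Tendsto (fun k : ℕ => 1 / ((k : ℝ) + 1)) atTop (𝓝 0) :=
    tendsto_one_div_add_atTop_nhds_zero_nat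
  have hinv' : Tendsto (fun k : ℕ => 1 / (k : ℝ)) atTop (𝓝 0) :=
    tendsto_one_div_atTop_nhds_zero_nat
  -- The flux over `k` is `greenRatio k` times this quotient, whose limit is `(1 / 6) / (1 / 3)`.
  have hq : Tendsto (fun k : ℕ => ((k : ℝ) * (k + 1) * (k + 2) / 6) / (rotorProfile k * k))
      atTop (𝓝 (1 / 2)) := by
    refine tendsto_of_tendsto_of_tendsto_of_le_of_le'
      (g := fun k : ℕ => 1 / 2 + 1 / 2 * (1 / ((k : ℝ) + 1)))
      (h := fun k : ℕ => 1 / 2 + 1 / 2 * (1 / (k : ℝ))) ?_ ?_ ?_ ?_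
    · simpa using (hinv.const_mul (1 / 2 : ℝ)).const_add (1 / 2 : ℝ)
    · simpa using (hinv'.const_mul (1 / 2 : ℝ)).const_add (1 / 2 : ℝ)
    · filter_upwards [eventually_gt_atTop 0] with k hk
      have hk' : (0 : ℝ) < k := by exact_mod_cast hk
      have hr : (0 : ℝ) < rotorProfile k := by exact_mod_cast rotorProfile_pos k hk
      calc 1 / 2 + 1 / 2 * (1 / ((k : ℝ) + 1)) =
          ((k : ℝ) * (k + 1) * (k + 2) / 6) / (((k : ℝ) + 1) ^ 2 / 3 * k) := by
            field_simp; ring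
        _ ≤ _ := by
          gcongr
          exact rotorProfile_upper k
    · filter_upwards [eventually_gt_atTop 0] with k hk
      have hk' : (0 : ℝ) < k := by exact_mod_cast hk
      calc ((k : ℝ) * (k + 1) * (k + 2) / 6) / (rotorProfile k * k) ≤
          ((k : ℝ) * (k + 1) * (k + 2) / 6) / ((k : ℝ) * (k + 2) / 3 * k) := by
            gcongr
            exact rotorProfile_lower k
        _ = _ := by field_simp; ring
  refine (hl.mul hq).congr' ?_
  filter_upwards [eventually_gt_atTop 0] with k hk
  have hk' : (0 : ℝ) < k := by exact_mod_cast hk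
  have hr : (0 : ℝ) < rotorProfile k := by exact_mod_cast rotorProfile_pos k hk
  rw [fluxProfile_mul hk, greenRatio]
  push_cast
  field_simp

theorem theorem3 :
    ∃ (e : ℕ → ℚ) (c : ℝ),
      (∀ x, 0 < e x) ∧ e 0 = 1 ∧
      Tendsto (fun x : ℕ => (e x : ℝ) / (x : ℝ)) atTop (𝓝 c) ∧ 0 < c ∧ c < 1 / 2 ∧
      ∀ m : ℕ, ∃ K : ℝ, 0 < K ∧
        ∀ z ∈ innerBoundary (combBall rotorProfile m),
          harmonicMeasure (combBall rotorProfile m) (0, 0) z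
            = K * (e (m - z.1.natAbs) : ℝ) := by
  obtain ⟨c, hc, hc0, hc1⟩ := fluxProfile_rotorProfile_tendsto
  have h0 : rotorProfile 0 = 0 := rfl
  refine ⟨fluxProfile rotorProfile, c, fluxProfile_pos rotorProfile_pos, by simp [fluxProfile], hc,
    hc0, hc1, fun m => ?_⟩
  -- For `m = 0` the origin is itself the boundary and the equation at the centre is not available.
  rcases Nat.eq_zero_or_pos m with rfl | hm
  · refine ⟨1, one_pos, fun z hz => ?_⟩
    have hbd := innerBoundary_combBall h0 0
    have hz0 : z = (0, 0) := by
      rw [hbd] at hz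
      obtain ⟨h1, h2⟩ := hz
      rw [Nat.zero_sub, h0] at h2
      ext <;> simp <;> omega
    subst hz0
    rw [harmonicMeasure_boundary hz hz]
    simp [fluxProfile]
  · set s : ℚ := greenProfile rotorProfile m - greenProfile rotorProfile (m - 1) +
      greenProfile rotorProfile m / rotorProfile m with hs
    have hs0 : 0 < s := by
      have h1 := (greenProfile_mono_pos rotorProfile (m - 1)).1
      rw [Nat.sub_add_cancel hm] at h1
      have h2 : 0 < greenProfile rotorProfile m / rotorProfile m :=
        div_pos (greenProfile_pos _ hm) (by exact_mod_cast rotorProfile_pos m hm)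
      linarith
    have hs0' : (0 : ℝ) < s := by exact_mod_cast hs0
    refine ⟨1 / (2 * s), by positivity, fun z hz => ?_⟩
    rw [← harmonicMeasure_combBall h0 rotorProfile_pos m hm z hz, ← hs]
    field_simp
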